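/- Let $\alpha,\beta\in\mathbb R$ and let $m\ge 0$ be an integer. Let $$P_m(x)=P_m^{(-\alpha-1,\beta-1)}(x)$$ be the Jacobi polynomial, where $P_n^{(a,b)}(x)=\frac{(a+1)_n}{n!}\,{}_2F_1\!\left(-n,n+a+b+1;a+1;\tfrac{1-x}{2}\right)$, continued polynomially in $a,b$, and assume $P_m\not\equiv 0$. With $x=-\cos 2\theta$, $0<\theta<\pi/2$, put $$W_m=-\frac{d}{dx}\ln\left((1+x)^{\beta/2-1/4}(1-x)^{-\alpha/2-1/4}P_m(x)\right),$$ $$A=2\sqrt{1-x^2}\left(\tfrac{d}{dx}+W_m\right),\qquad A^\dagger=2\sqrt{1-x^2}\left(-\tfrac{d}{dx}+W_m\right),$$ $$L^{(2)}=AA^\dagger+(2m-\alpha+\beta-1)^2,\qquad H=-\frac1{2r}\partial_r r\partial_r+\frac12\omega^2r^2+\frac1{2r^2}L^{(2)}\qquad(\omega\in\mathbb R).$$ Consider these on $r>0$, $0<\theta<\pi/2$, away from the zeros of $P_m(-\cos2\theta)$. Then: 1. $H=-\frac12\Delta+V$, where $V=\frac12\omega^2r^2+r^{-2}S(\theta)$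 and $S(\theta)=\dfrac{N(x)}{(1-x^2)P_m(x)^2}$ for a real polynomial $N$ independent of $\omega$. 2. There are a rational function $W(y)$, of the form (real polynomial in $y$)$/P_m(1-2y)$, and real constants $q_7,\dots,q_{10}$, all independent of $\omega$, such that $$V=\frac12\omega^2r^2+\frac1{r^2}T'(\theta),\qquad T(\theta)=\frac{-2W(y)}{\sin\theta\cos\theta}-\frac{\kappa}{\tan2\theta},\qquad y=\tfrac12(1+\cos2\theta),$$ with $\kappa=\alpha^2-\alpha\beta+\beta^2+\frac74+2(m-1)(m+\beta-\alpha)$ (and $1/\tan 2\theta$ read as $\cot 2\theta$), and such that, at all $y\in(0,1)$ with $P_m(1-2y)\neq0$, $W$ satisfies Cosgrove's equation SD-I.a $$y^2(1-y)^2(W'')^2+4W'(yW'-W)^2-4(W')^2(yW'-W)+4q_7(W')^2+4q_8W'+4q_9(yW'-W)+4q_{10}=0 .$$ 3. $W$, hence the potential, is expressed through a sixth Painlevé transcendent: there are real $\gamma_1,\dots,\gamma_4$, a real $t$ with $t^2=2\gamma_1$, and a function $u$ that, on $(0,1)$ minus a finite set, is analytic, avoids the values $0,1,y$, solves $$u''=\tfrac12\left(\tfrac1u+\tfrac1{u-1}+\tfrac1{u-y}\right)u'^2-\left(\tfrac1y+\tfrac1{y-1}+\tfrac1{u-y}\right)u'+\tfrac{u(u-1)(u-y)}{y^2(y-1)^2}\left(\gamma_1+\tfrac{\gamma_2y}{u^2}+\tfrac{\gamma_3(y-1)}{(u-1)^2}+\tfrac{\gamma_4y(y-1)}{(u-y)^2}\right),$$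 and satisfies $$W=\tfrac{y^2(y-1)^2}{4u(u-1)(u-y)}\left(u'-\tfrac{u(u-1)}{y(y-1)}\right)^2+\tfrac18(1-t)^2(1-2u)-\tfrac{\gamma_2}4\left(1-\tfrac{2y}{u}\right)-\tfrac{\gamma_3}4\left(1-\tfrac{2(y-1)}{u-1}\right)+\left(\tfrac18-\tfrac{\gamma_4}4\right)\left(1-\tfrac{2y(u-1)}{u-y}\right).$$ The family is infinite: if $\alpha-\beta\notin\mathbb Z$, then $P_m\not\equiv0$ for every $m\ge0$, and for $m\ne n$ there is an angle $\theta\in(0,\pi/2)$, regular for both potentials, at which the potentials of index $m$ and $n$ (for the same $\omega$) differ for every $\omega$ and every $r>0$. -/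

import Mathlib

open scoped Polynomial

noncomputable section

namespace RationalExtension

/-- The Jacobi polynomial `P_n^{(a,b)}`, that is
`((a+1)_n / n!) ₂F₁(-n, n+a+b+1; a+1; (1-x)/2)`, written with the factor `(a+1)_n / (a+1)_k`
simplified to `(a+k+1)_{n-k}`, so that it makes sense for all real `a`, `b`. -/
def jacobiPoly (n : ℕ) (a b : ℝ) : ℝ[X] :=
  ∑ k ∈ Finset.range (n + 1),
    Polynomial.C ((ascPochhammer ℝ k).eval (n + a + b + 1)
        * (ascPochhammer ℝ (n - k)).eval (a + k + 1)
        / ((k.factorial : ℝ) * ((n - k).factorial : ℝ)))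
      * (Polynomial.C (1 / 2) * (Polynomial.X - 1)) ^ k

/-- The polynomial `P_m^{(-α-1, β-1)}` of the Jacobi seed function. -/
def seedPoly (m : ℕ) (α β : ℝ) : ℝ[X] := jacobiPoly m (-α - 1) (β - 1)

/-- The seed function `(1+x)^{β/2-1/4} (1-x)^{-α/2-1/4} P_m^{(-α-1, β-1)}(x)` on `-1 < x < 1`. -/
def seed (m : ℕ) (α β x : ℝ) : ℝ :=
  (1 + x) ^ (β / 2 - 1 / 4) * (1 - x) ^ (-α / 2 - 1 / 4) * (seedPoly m α β).eval x

/-- The superpotential `-(d/dx) ln (seed)`; with this sign `d/dx + superpotential` annihilates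
the seed function. -/
def superpotential (m : ℕ) (α β x : ℝ) : ℝ := -logDeriv (seed m α β) x

/-- `A = 2 √(1-x²) (d/dx + superpotential)`. -/
def opA (m : ℕ) (α β : ℝ) (f : ℝ → ℝ) (x : ℝ) : ℝ :=
  2 * √(1 - x ^ 2) * (deriv f x + superpotential m α β x * f x)

/-- `A† = 2 √(1-x²) (-d/dx + superpotential)`. -/
def opAdag (m : ℕ) (α β : ℝ) (f : ℝ → ℝ) (x : ℝ) : ℝ :=
  2 * √(1 - x ^ 2) * (-deriv f x + superpotential m α β x * f x)

/-- The exceptional angular operator `L⁽²⁾ = A A† + (2m - α + β - 1)²`. The constant is the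
eigenvalue of the seed function, so that `A† A + (2m - α + β - 1)²` is the classical operator
`-∂_θ² + ((α+1)² - 1/4)/cos² θ + ((β-1)² - 1/4)/sin² θ`, where `x = -cos 2θ`. -/
def angularOp (m : ℕ) (α β : ℝ) (f : ℝ → ℝ) (x : ℝ) : ℝ :=
  opA m α β (opAdag m α β f) x + (2 * m - α + β - 1) ^ 2 * f x

/-- The exceptional Hamiltonian `-(1/(2r)) ∂_r r ∂_r + ω² r²/2 + L⁽²⁾/(2r²)`, acting on
functions of `(r, x)`, where `x = -cos 2θ`. -/
def hamiltonian (ω : ℝ) (m : ℕ) (α β : ℝ) (Ψ : ℝ → ℝ → ℝ) (r x : ℝ) : ℝ :=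
  -(1 / (2 * r)) * deriv (fun ρ => ρ * deriv (fun s => Ψ s x) ρ) r
    + ω ^ 2 * r ^ 2 / 2 * Ψ r x
    + 1 / (2 * r ^ 2) * angularOp m α β (Ψ r) x

/-- The Euclidean Laplacian of the plane in polar coordinates. -/
def polarLaplacian (ψ : ℝ → ℝ → ℝ) (r θ : ℝ) : ℝ :=
  deriv (deriv fun s => ψ s θ) r + 1 / r * deriv (fun s => ψ s θ) r
    + 1 / r ^ 2 * deriv (deriv fun t => ψ r t) θ

/-- The potential of the Hamiltonian: if `H = -Δ/2 + V`, then `V` is the value of `H` on the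
constant function `1`. -/
def potential (ω : ℝ) (m : ℕ) (α β r θ : ℝ) : ℝ :=
  hamiltonian ω m α β (fun _ _ => 1) r (-Real.cos (2 * θ))

/-- The angles of the open first quadrant at which the potential is regular. -/
def regularAngles (m : ℕ) (α β : ℝ) : Set ℝ :=
  {θ | 0 < θ ∧ θ < Real.pi / 2 ∧ (seedPoly m α β).eval (-Real.cos (2 * θ)) ≠ 0}

/-- The values of `y = (1 + cos 2θ)/2 = (1 - x)/2` at the regular angles. -/
def regularPoints (m : ℕ) (α β : ℝ) : Set ℝ :=
  {y | 0 < y ∧ y < 1 ∧ (seedPoly m α β).eval (1 - 2 * y) ≠ 0}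

/-- The constant in front of `cot 2θ` in the angular primitive; it equals
`α² - αβ + β² + 7/4` for `m = 1`. -/
def cotCoeff (m : ℕ) (α β : ℝ) : ℝ :=
  α ^ 2 - α * β + β ^ 2 + 7 / 4 + 2 * (m - 1) * (m + β - α)

/-- The function `T(θ) = -2 W(y)/(sin θ cos θ) - κ cot 2θ` with `y = (1 + cos 2θ)/2`. -/
def angularPrimitive (κ : ℝ) (W : ℝ → ℝ) (θ : ℝ) : ℝ :=
  -2 * W ((1 + Real.cos (2 * θ)) / 2) / (Real.sin θ * Real.cos θ)
    - κ * (Real.cos (2 * θ) / Real.sin (2 * θ))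

/-- `W` is an analytic solution on `D` of the equation SD-I.a
`y²(1-y)²W''² + 4W'(yW'-W)² - 4W'²(yW'-W) + 4q₇W'² + 4q₈W' + 4q₉(yW'-W) + 4q₁₀ = 0`. -/
def IsSDIaSolutionOn (q₇ q₈ q₉ q₁₀ : ℝ) (W : ℝ → ℝ) (D : Set ℝ) : Prop :=
  ∀ y ∈ D, AnalyticAt ℝ W y ∧
    y ^ 2 * (1 - y) ^ 2 * deriv (deriv W) y ^ 2
      + 4 * deriv W y * (y * deriv W y - W y) ^ 2
      - 4 * deriv W y ^ 2 * (y * deriv W y - W y)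
      + 4 * q₇ * deriv W y ^ 2 + 4 * q₈ * deriv W y
      + 4 * q₉ * (y * deriv W y - W y) + 4 * q₁₀ = 0

/-- `u` is an analytic solution on `D` of the sixth Painlevé equation with parameters
`γ₁, γ₂, γ₃, γ₄`; in particular it avoids the values `0`, `1`, `y` there. -/
def IsPVISolutionOn (γ₁ γ₂ γ₃ γ₄ : ℝ) (u : ℝ → ℝ) (D : Set ℝ) : Prop :=
  ∀ y ∈ D, y ≠ 0 ∧ y ≠ 1 ∧ AnalyticAt ℝ u y ∧ u y ≠ 0 ∧ u y ≠ 1 ∧ u y ≠ y ∧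
    deriv (deriv u) y =
      1 / 2 * (1 / u y + 1 / (u y - 1) + 1 / (u y - y)) * deriv u y ^ 2
      - (1 / y + 1 / (y - 1) + 1 / (u y - y)) * deriv u y
      + u y * (u y - 1) * (u y - y) / (y ^ 2 * (y - 1) ^ 2)
        * (γ₁ + γ₂ * y / u y ^ 2 + γ₃ * (y - 1) / (u y - 1) ^ 2
          + γ₄ * y * (y - 1) / (u y - y) ^ 2)

/-- Cosgrove's expression of the solutions of SD-I.a through a function `u` that solves the sixth
Painlevé equation with parameters `γ₁, γ₂, γ₃, γ₄`; here `t` is one of the square roots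
of `2γ₁`. -/
def cosgroveExpr (γ₂ γ₃ γ₄ t : ℝ) (u : ℝ → ℝ) (y : ℝ) : ℝ :=
  y ^ 2 * (y - 1) ^ 2 / (4 * u y * (u y - 1) * (u y - y))
      * (deriv u y - u y * (u y - 1) / (y * (y - 1))) ^ 2
    + 1 / 8 * (1 - t) ^ 2 * (1 - 2 * u y)
    - 1 / 4 * γ₂ * (1 - 2 * y / u y)
    - 1 / 4 * γ₃ * (1 - 2 * (y - 1) / (u y - 1))
    + (1 / 8 - 1 / 4 * γ₄) * (1 - 2 * y * (u y - 1) / (u y - y))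

end RationalExtension

end

/-!
The seed function is an eigenfunction of a Pöschl–Teller operator, so the angular operator is its
Darboux transform: a Pöschl–Teller potential plus derivatives of `ln P_m`, hence rational in
`x = -cos 2θ`. In the variable `y = (1-x)/2` the polynomial `q = P_m(1-2y)` solves a hypergeometric
equation, so `F = y(1-y)q'/q` solves a Riccati equation. Modulo that equation `F'` and `F''` are
polynomials in `F`, and both SD-I.a for `W = affine - F` and Painlevé VI for a function `u` affine
in `F` become polynomial identities in `F`. This fails only if `u` takes one of the values `0`, `1`,
`y` infinitely often; then `F` and `W` are affine, and an affine `W` is represented by the Painlevé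
function attached to the solution `F = 0` of another Riccati equation.

If the potentials attached to two polynomials `p` and `q` agree, then
`(y(1-y))^{1/2} w/(pq)` is constant, where `w` is the Wronskian of `p` and `q`. Squaring and
comparing the multiplicities of the root `0`, which are odd on one side and even on the other unless
`w = 0`, shows that `p` and `q` are proportional. In the generic case `P_m` has degree `m`, so
distinct indices give distinct potentials.
-/

noncomputable section

namespace RationalExtension

open Polynomial Filter Topology

section Wronskian

theorem exists_eq_C_mul_of_wronskian_eq_zero {K : Type*} [Field K] [CharZero K] {p q : K[X]}
    (hq : q ≠ 0) (h : wronskian p q = 0) : ∃ k : K, p = C k * q := by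
  classical
  let := EuclideanDomain.gcdMonoid K[X]
  obtain ⟨p₁, q₁, hp, hq', hunit⟩ := extract_gcd p q
  have hd : gcd p q ≠ 0 := gcd_ne_zero_of_right hq
  generalize gcd p q = d at hp hq' hd
  subst hp hq'
  have hw : wronskian p₁ q₁ = 0 := by
    have hexpand : wronskian (d * p₁) (d * q₁) = d ^ 2 * wronskian p₁ q₁ := by
      simp only [wronskian, derivative_mul]
      ring
    exact (mul_eq_zero.1 (hexpand.symm.trans h)).resolve_left (pow_ne_zero 2 hd)
  obtain ⟨hp₁, hq₁⟩ := ((gcd_isUnit_iff p₁ q₁).1 hunit).wronskian_eq_zero_iff.1 hw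
  obtain ⟨e, rfl⟩ : ∃ e, p₁ = C e := ⟨_, eq_C_of_derivative_eq_zero hp₁⟩
  obtain ⟨e', rfl⟩ : ∃ e', q₁ = C e' := ⟨_, eq_C_of_derivative_eq_zero hq₁⟩
  have he' : e' ≠ 0 := by
    rintro rfl
    simp at hq
  exact ⟨e / e', by rw [mul_left_comm, ← C_mul, div_mul_cancel₀ _ he']⟩

variable {R : Type*} [CommRing R]

theorem wronskian_X_mul_one_sub_X_mul_sq (p q : R[X]) :
    wronskian (X * (1 - X) * p ^ 2) (q ^ 2) =
      -(p * q * ((1 - 2 * X) * p * q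
        + 2 * X * (1 - X) * (derivative p * q - p * derivative q))) := by
  simp only [wronskian, derivative_mul, derivative_sub, derivative_sq, derivative_X, derivative_one]
  rw [C_ofNat]
  ring

variable [IsDomain R] {f q z : R[X]}

theorem rootMultiplicity_sq (r : R) (p : R[X]) :
    (p ^ 2).rootMultiplicity r = 2 * p.rootMultiplicity r := by
  classical
  rw [← count_roots, ← count_roots, roots_pow, Multiset.count_nsmul]

theorem eq_zero_of_mul_sq_eq_C_mul_sq {k r : R} (hf : Odd (f.rootMultiplicity r))
    (h : f * z ^ 2 = C k * q ^ 2) : z = 0 := by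
  by_contra hz
  have hf0 : f ≠ 0 := by
    rintro rfl
    simp at hf
  have hleft : f * z ^ 2 ≠ 0 := mul_ne_zero hf0 (pow_ne_zero 2 hz)
  have hmult := congrArg (rootMultiplicity r) h
  rw [rootMultiplicity_mul hleft, rootMultiplicity_mul (h ▸ hleft), rootMultiplicity_sq,
    rootMultiplicity_sq, rootMultiplicity_C] at hmult
  obtain ⟨j, hj⟩ := hf
  lia

theorem rootMultiplicity_zero_X_mul_one_sub_X :
    (X * (1 - X) : R[X]).rootMultiplicity 0 = 1 := by
  have hroot : ¬(1 - X : R[X]).IsRoot 0 := by simp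
  have hne : (1 - X : R[X]) ≠ 0 := fun h => hroot (h ▸ eval_zero)
  have hX := rootMultiplicity_X_sub_C_self (x := (0 : R))
  rw [C_0, sub_zero] at hX
  rw [rootMultiplicity_mul (mul_ne_zero X_ne_zero hne), hX, rootMultiplicity_eq_zero hroot]

end Wronskian

section Riccati

variable {a b c y : ℝ} {F : ℝ → ℝ} {s : Set ℝ}

/-- `F` is an analytic solution on `s` of the Riccati equation
`y(1-y)F' = ab y(1-y) + (1-c+(a+b-1)y)F - F²`, which the substitution `F = y(1-y)q'/q` turns into
the hypergeometric equation for `q`. The equation is required in a neighbourhood of every point of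
`s`, so that it may be differentiated there. -/
def IsRiccatiSolutionOn (a b c : ℝ) (F : ℝ → ℝ) (s : Set ℝ) : Prop :=
  ∀ y ∈ s, y ≠ 0 ∧ y ≠ 1 ∧ AnalyticAt ℝ F y ∧
    ∀ᶠ z in 𝓝 y, z * (1 - z) * deriv F z =
      a * b * (z * (1 - z)) + (1 - c + (a + b - 1) * z) * F z - F z ^ 2

theorem IsRiccatiSolutionOn.deriv_eq (h : IsRiccatiSolutionOn a b c F s) (hy : y ∈ s) :
    deriv F y = a * b + ((1 - c + (a + b - 1) * y) * F y - F y ^ 2) / (y * (1 - y)) := by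
  obtain ⟨hy0, hy1, -, hF⟩ := h y hy
  have hy1' : 1 - y ≠ 0 := sub_ne_zero.2 hy1.symm
  field_simp
  linear_combination hF.self_of_nhds

theorem IsRiccatiSolutionOn.deriv_deriv_eq (h : IsRiccatiSolutionOn a b c F s) (hy : y ∈ s) :
    deriv (deriv F) y = (a * b * (1 - 2 * y) + (a + b - 1) * F y
      + (-c + (a + b + 1) * y - 2 * F y) * deriv F y) / (y * (1 - y)) := by
  obtain ⟨hy0, hy1, hFy, hF⟩ := h y hy
  have hy1' : 1 - y ≠ 0 := sub_ne_zero.2 hy1.symm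
  have hid := hasDerivAt_id' y
  have hF' := hFy.differentiableAt.hasDerivAt
  have hw := hid.mul (hid.const_sub 1)
  have hlhs := hw.mul hFy.deriv.differentiableAt.hasDerivAt
  have hrhs := ((hw.const_mul (a * b)).add
    (((hid.const_mul (a + b - 1)).const_add (1 - c)).mul hF')).sub (hF'.pow 2)
  have key := hlhs.unique (hrhs.congr_of_eventuallyEq hF)
  simp only [Pi.mul_apply] at key
  push_cast at key
  field_simp
  linear_combination key

/-- The solution of SD-I.a attached to a solution `F` of the Riccati equation. -/
def cosgroveFun (a b c : ℝ) (F : ℝ → ℝ) (y : ℝ) : ℝ :=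
  ((a + b) ^ 2 + 1 - c * (a + b + 1) - 2 * a * b) / 4 + (a * b - (a + b - 1) ^ 2 / 4) * y - F y

theorem hasDerivAt_cosgroveFun {F' : ℝ} (hF : HasDerivAt F F' y) :
    HasDerivAt (cosgroveFun a b c F) (a * b - (a + b - 1) ^ 2 / 4 - F') y := by
  have h := (((hasDerivAt_id' y).const_mul (a * b - (a + b - 1) ^ 2 / 4)).const_add
    (((a + b) ^ 2 + 1 - c * (a + b + 1) - 2 * a * b) / 4)).sub hF
  rwa [mul_one] at h

theorem analyticAt_cosgroveFun (hF : AnalyticAt ℝ F y) : AnalyticAt ℝ (cosgroveFun a b c F) y :=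
  (analyticAt_const.add (analyticAt_const.mul analyticAt_id)).sub hF

theorem deriv_deriv_cosgroveFun (hF : AnalyticAt ℝ F y) :
    deriv (deriv (cosgroveFun a b c F)) y = -deriv (deriv F) y := by
  have h : deriv (cosgroveFun a b c F) =ᶠ[𝓝 y]
      fun z => a * b - (a + b - 1) ^ 2 / 4 - deriv F z :=
    hF.eventually_analyticAt.mono fun z hz =>
      (hasDerivAt_cosgroveFun hz.differentiableAt.hasDerivAt).deriv
  rw [h.deriv_eq, deriv_const_sub]

-- The constants are written in the exponent differences `lam`, `mu`, `nu` of the hypergeometric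
-- equation at `0`, `1` and `∞`.
theorem IsRiccatiSolutionOn.isSDIaSolutionOn {lam mu nu : ℝ} (h : IsRiccatiSolutionOn a b c F s)
    (hlam : lam = 1 - c) (hmu : mu = c - a - b) (hnu : nu = a - b) :
    IsSDIaSolutionOn (-(1 + lam ^ 2 + mu ^ 2 + nu ^ 2) / 8)
      (-((lam ^ 2 - mu ^ 2) ^ 2 + (1 - nu ^ 2) ^ 2 + 2 * lam ^ 2 * (1 + 3 * nu ^ 2)
        + 2 * mu ^ 2 * (3 + nu ^ 2)) / 64)
      ((lam ^ 2 - mu ^ 2) * (nu ^ 2 - 1) / 16)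
      (-((lam ^ 2 + mu ^ 2) * (1 - nu ^ 2) ^ 2 + (lam ^ 2 - mu ^ 2) ^ 2 * (1 + nu ^ 2)) / 128)
      (cosgroveFun a b c F) s := by
  intro y hy
  obtain ⟨hy0, hy1, hFy, -⟩ := h y hy
  refine ⟨analyticAt_cosgroveFun hFy, ?_⟩
  have hy1' : 1 - y ≠ 0 := sub_ne_zero.2 hy1.symm
  rw [deriv_deriv_cosgroveFun hFy, h.deriv_deriv_eq hy,
    (hasDerivAt_cosgroveFun hFy.differentiableAt.hasDerivAt).deriv, h.deriv_eq hy, cosgroveFun]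
  subst hlam hmu hnu
  generalize F y = v
  field_simp
  ring

/-- The solution of the sixth Painlevé equation attached to a solution `F` of the Riccati equation:
the affine change of `F` that turns its equation into one of the Riccati equations whose solutions
solve Painlevé VI. -/
def pviFun (a b c : ℝ) (F : ℝ → ℝ) (y : ℝ) : ℝ :=
  (1 - c + b * y - F y) / (1 - a)

/-- The points of `s` at which `pviFun a b c F` takes one of the values `0`, `1`, `y` excluded by
the sixth Painlevé equation. -/
def pviExceptionalSet (a b c : ℝ) (F : ℝ → ℝ) (s : Set ℝ) : Set ℝ :=
  {y ∈ s | pviFun a b c F y = 0 ∨ pviFun a b c F y = 1 ∨ pviFun a b c F y = y}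

theorem hasDerivAt_pviFun {F' : ℝ} (hF : HasDerivAt F F' y) :
    HasDerivAt (pviFun a b c F) ((b - F') / (1 - a)) y := by
  have h := ((((hasDerivAt_id' y).const_mul b).const_add (1 - c)).sub hF).div_const (1 - a)
  rwa [mul_one] at h

theorem analyticAt_pviFun (hF : AnalyticAt ℝ F y) : AnalyticAt ℝ (pviFun a b c F) y :=
  ((analyticAt_const.add (analyticAt_const.mul analyticAt_id)).sub hF).div_const

theorem deriv_deriv_pviFun (hF : AnalyticAt ℝ F y) :
    deriv (deriv (pviFun a b c F)) y = -deriv (deriv F) y / (1 - a) := by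
  have h : deriv (pviFun a b c F) =ᶠ[𝓝 y] fun z => (b - deriv F z) / (1 - a) :=
    hF.eventually_analyticAt.mono fun z hz =>
      (hasDerivAt_pviFun hz.differentiableAt.hasDerivAt).deriv
  rw [h.deriv_eq, deriv_div_const, deriv_const_sub]

theorem eq_sub_mul_pviFun (ha : a ≠ 1) : F y = 1 - c + b * y - (1 - a) * pviFun a b c F y := by
  rw [pviFun, mul_div_cancel₀ _ (sub_ne_zero.2 ha.symm)]
  ring

theorem IsRiccatiSolutionOn.deriv_pviFun (h : IsRiccatiSolutionOn a b c F s) (ha : a ≠ 1)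
    (hy : y ∈ s) :
    deriv (pviFun a b c F) y =
      ((a - 1) * pviFun a b c F y ^ 2 + ((b - a + 1) * y + 1 - c) * pviFun a b c F y
        - (b + 1 - c) * y) / (y * (y - 1)) := by
  obtain ⟨hy0, hy1, hFy, -⟩ := h y hy
  have hy1' : y - 1 ≠ 0 := sub_ne_zero.2 hy1
  have hy1'' : 1 - y ≠ 0 := sub_ne_zero.2 hy1.symm
  have ha' : 1 - a ≠ 0 := sub_ne_zero.2 ha.symm
  rw [(hasDerivAt_pviFun hFy.differentiableAt.hasDerivAt).deriv, h.deriv_eq hy,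
    eq_sub_mul_pviFun (F := F) (b := b) (c := c) (y := y) ha]
  generalize pviFun a b c F y = v
  field_simp
  ring

theorem IsRiccatiSolutionOn.isPVISolutionOn_pviFun (h : IsRiccatiSolutionOn a b c F s)
    (ha : a ≠ 1) :
    IsPVISolutionOn ((a - 1) ^ 2 / 2) (-(b + 1 - c) ^ 2 / 2) ((a - c) ^ 2 / 2)
      ((1 - (b - 1) ^ 2) / 2) (pviFun a b c F) (s \ pviExceptionalSet a b c F s) := by
  rintro y ⟨hy, hyS⟩
  obtain ⟨hy0, hy1, hFy, -⟩ := h y hy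
  have hv : ¬(pviFun a b c F y = 0 ∨ pviFun a b c F y = 1 ∨ pviFun a b c F y = y) :=
    fun hv => hyS ⟨hy, hv⟩
  push Not at hv
  obtain ⟨hv0, hv1, hvy⟩ := hv
  refine ⟨hy0, hy1, analyticAt_pviFun hFy, hv0, hv1, hvy, ?_⟩
  have hy1' : y - 1 ≠ 0 := sub_ne_zero.2 hy1
  have hy1'' : 1 - y ≠ 0 := sub_ne_zero.2 hy1.symm
  have ha' : 1 - a ≠ 0 := sub_ne_zero.2 ha.symm
  rw [deriv_deriv_pviFun hFy, h.deriv_deriv_eq hy, h.deriv_pviFun ha hy, h.deriv_eq hy,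
    eq_sub_mul_pviFun (F := F) (b := b) (c := c) (y := y) ha]
  generalize pviFun a b c F y = v at *
  have hv1' : v - 1 ≠ 0 := sub_ne_zero.2 hv1
  have hvy' : v - y ≠ 0 := sub_ne_zero.2 hvy
  field_simp
  ring

theorem IsRiccatiSolutionOn.cosgroveExpr_pviFun (h : IsRiccatiSolutionOn a b c F s) (ha : a ≠ 1)
    (hy : y ∈ s \ pviExceptionalSet a b c F s) :
    cosgroveExpr (-(b + 1 - c) ^ 2 / 2) ((a - c) ^ 2 / 2) ((1 - (b - 1) ^ 2) / 2) (1 - a)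
      (pviFun a b c F) y = cosgroveFun a b c F y := by
  obtain ⟨hy0, hy1, -, hv0, hv1, hvy, -⟩ := h.isPVISolutionOn_pviFun ha y hy
  have hy1' : y - 1 ≠ 0 := sub_ne_zero.2 hy1
  have hv1' : pviFun a b c F y - 1 ≠ 0 := sub_ne_zero.2 hv1
  have hvy' : pviFun a b c F y - y ≠ 0 := sub_ne_zero.2 hvy
  rw [cosgroveExpr, h.deriv_pviFun ha hy.1, cosgroveFun,
    eq_sub_mul_pviFun (F := F) (b := b) (c := c) (y := y) ha]
  generalize pviFun a b c F y = v at *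
  field_simp
  ring

-- Replacing `t` by `-t` adds `t (1 - 2u) / 2`, which cancels `F`.
theorem IsRiccatiSolutionOn.cosgroveExpr_pviFun_neg (h : IsRiccatiSolutionOn a b c F s)
    (ha : a ≠ 1) (hy : y ∈ s \ pviExceptionalSet a b c F s) :
    cosgroveExpr (-(b + 1 - c) ^ 2 / 2) ((a - c) ^ 2 / 2) ((1 - (b - 1) ^ 2) / 2) (a - 1)
      (pviFun a b c F) y =
        (a + b - 3) * (a + b + 1 - 2 * c) / 8 + (b - a + 1) ^ 2 * (1 - 2 * y) / 8 := by
  have hpos := h.cosgroveExpr_pviFun ha hy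
  rw [cosgroveFun, eq_sub_mul_pviFun (F := F) (b := b) (c := c) (y := y) ha] at hpos
  rw [cosgroveExpr] at hpos ⊢
  linear_combination hpos

end Riccati

section Painleve

variable {W : ℝ → ℝ} {s : Set ℝ}

/-- `W` is Cosgrove's expression in a solution of the sixth Painlevé equation on `s`, up to a finite
set. -/
def HasPVIRepresentation (W : ℝ → ℝ) (s : Set ℝ) : Prop :=
  ∃ (γ₁ γ₂ γ₃ γ₄ t : ℝ) (u : ℝ → ℝ) (S : Set ℝ), t ^ 2 = 2 * γ₁ ∧ S.Finite ∧
    IsPVISolutionOn γ₁ γ₂ γ₃ γ₄ u (s \ S) ∧ ∀ y ∈ s \ S, W y = cosgroveExpr γ₂ γ₃ γ₄ t u y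

theorem HasPVIRepresentation.congr {W' : ℝ → ℝ} (h : HasPVIRepresentation W s)
    (hW : ∀ y ∈ s, W' y = W y) : HasPVIRepresentation W' s := by
  obtain ⟨γ₁, γ₂, γ₃, γ₄, t, u, S, ht, hS, hu, hWu⟩ := h
  exact ⟨γ₁, γ₂, γ₃, γ₄, t, u, S, ht, hS, hu, fun y hy => (hW y hy.1).trans (hWu y hy)⟩

theorem IsRiccatiSolutionOn.hasPVIRepresentation {a b c : ℝ} {F : ℝ → ℝ}
    (h : IsRiccatiSolutionOn a b c F s) (ha : a ≠ 1)
    (hS : (pviExceptionalSet a b c F s).Finite) :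
    HasPVIRepresentation (cosgroveFun a b c F) s :=
  ⟨_, _, _, _, 1 - a, _, _, by ring, hS, h.isPVISolutionOn_pviFun ha,
    fun _ hy => (h.cosgroveExpr_pviFun ha hy).symm⟩

theorem isRiccatiSolutionOn_zero (b c : ℝ) (hs : ∀ y ∈ s, y ≠ 0 ∧ y ≠ 1) :
    IsRiccatiSolutionOn 0 b c 0 s :=
  fun y hy => ⟨(hs y hy).1, (hs y hy).2, analyticAt_const, .of_forall fun z => by simp⟩

-- An affine `W` of slope `-d²/4` comes from `F = 0` and `a = 0`, the sign of `t` being the one for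
-- which Cosgrove's expression is affine; `b ≤ -1` keeps the slope of the affine function `u` away
-- from `0` and `1`.
theorem hasPVIRepresentation_of_affine {k d : ℝ} (hs : ∀ y ∈ s, y ≠ 0 ∧ y ≠ 1)
    (hW : ∀ y ∈ s, W y = k - d ^ 2 / 4 * y) : HasPVIRepresentation W s := by
  obtain ⟨b, hb, hbd⟩ : ∃ b : ℝ, b ≤ -1 ∧ (b + 1) ^ 2 = d ^ 2 :=
    ⟨-1 - |d|, by linarith [abs_nonneg d], by rw [← sq_abs d]; ring⟩
  have hb3 : b - 3 ≠ 0 := by linarith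
  obtain ⟨c, hc⟩ : ∃ c : ℝ, (b - 3) * (b + 1 - 2 * c) / 8 + (b + 1) ^ 2 / 8 = k :=
    ⟨(b + 1 - (8 * k - (b + 1) ^ 2) / (b - 3)) / 2, by field_simp; ring⟩
  have h := isRiccatiSolutionOn_zero b c hs
  have hS : (pviExceptionalSet 0 b c 0 s).Finite := by
    refine (Set.toFinite {(c - 1) / b, c / b, (c - 1) / (b - 1)}).subset ?_
    have hb0 : b ≠ 0 := by linarith
    have hb1 : b - 1 ≠ 0 := by linarith
    rintro y ⟨-, hy⟩
    simp only [pviFun, Pi.zero_apply, sub_zero, div_one] at hy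
    simp only [Set.mem_insert_iff, Set.mem_singleton_iff, eq_div_iff hb0, eq_div_iff hb1]
    rcases hy with hy | hy | hy
    · exact .inl (by linear_combination hy)
    · exact .inr (.inl (by linear_combination hy))
    · exact .inr (.inr (by linear_combination hy))
  refine ⟨_, _, _, _, 0 - 1, _, _, by ring, hS, h.isPVISolutionOn_pviFun zero_ne_one, ?_⟩
  intro y hy
  rw [h.cosgroveExpr_pviFun_neg zero_ne_one hy, hW y hy.1]
  linear_combination -hc + y / 4 * hbd

theorem IsSDIaSolutionOn.congr {W' : ℝ → ℝ} {q₇ q₈ q₉ q₁₀ : ℝ}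
    (h : IsSDIaSolutionOn q₇ q₈ q₉ q₁₀ W s) (hW : ∀ y ∈ s, W' =ᶠ[𝓝 y] W) :
    IsSDIaSolutionOn q₇ q₈ q₉ q₁₀ W' s := by
  intro y hy
  have hWy := hW y hy
  rw [hWy.deriv.deriv_eq, hWy.deriv_eq, hWy.eq_of_nhds]
  exact ⟨(h y hy).1.congr hWy.symm, (h y hy).2⟩

end Painleve

section Hypergeometric

/-- The polynomial `q` solves the hypergeometric equation
`y(1-y)q'' + (c - (a+b+1)y)q' - ab q = 0`. -/
def IsHypergeometric (a b c : ℝ) (q : ℝ[X]) : Prop :=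
  X * (1 - X) * derivative (derivative q) + (C c - C (a + b + 1) * X) * derivative q
    - C (a * b) * q = 0

variable {a b c y : ℝ} {q : ℝ[X]} {s : Set ℝ}

theorem isHypergeometric_iff_coeff :
    IsHypergeometric a b c q ↔
      ∀ k : ℕ, (k + 1) * (k + c) * q.coeff (k + 1) = (k + a) * (k + b) * q.coeff k := by
  have hexpand : X * (1 - X) * derivative (derivative q)
      + (C c - C (a + b + 1) * X) * derivative q - C (a * b) * q =
      X * derivative (derivative q) - X * (X * derivative (derivative q))
        + C c * derivative q - C (a + b + 1) * (X * derivative q) - C (a * b) * q := by ring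
  rw [IsHypergeometric, hexpand, Polynomial.ext_iff]
  refine forall_congr' fun k => ?_
  simp only [coeff_add, coeff_sub, coeff_C_mul, coeff_zero]
  rcases k with _ | _ | k <;>
    simp only [coeff_X_mul_zero, coeff_X_mul, coeff_derivative] <;> push_cast <;>
    constructor <;> intro h <;> linear_combination h

theorem IsHypergeometric.eval_eq (h : IsHypergeometric a b c q) (y : ℝ) :
    y * (1 - y) * q.derivative.derivative.eval y + (c - (a + b + 1) * y) * q.derivative.eval y
      - a * b * q.eval y = 0 := by
  simpa only [eval_add, eval_sub, eval_mul, eval_X, eval_one, eval_C, eval_zero] using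
    congrArg (eval y) h

/-- The function `y(1-y)q'/q`, which turns the hypergeometric equation into a Riccati equation. -/
def weightedLogDeriv (q : ℝ[X]) (y : ℝ) : ℝ :=
  y * (1 - y) * q.derivative.eval y / q.eval y

theorem hasDerivAt_weightedLogDeriv (hq : q.eval y ≠ 0) :
    HasDerivAt (weightedLogDeriv q)
      (((1 - 2 * y) * q.derivative.eval y + y * (1 - y) * q.derivative.derivative.eval y)
          / q.eval y - y * (1 - y) * (q.derivative.eval y / q.eval y) ^ 2) y := by
  have h := (((hasDerivAt_id' y).mul ((hasDerivAt_id' y).const_sub 1)).mul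
    (q.derivative.hasDerivAt y)).div (q.hasDerivAt y) hq
  refine h.congr_deriv ?_
  simp only [Pi.mul_apply]
  field_simp
  ring

theorem analyticAt_weightedLogDeriv (hq : q.eval y ≠ 0) : AnalyticAt ℝ (weightedLogDeriv q) y :=
  ((analyticAt_id.mul (analyticAt_const.sub analyticAt_id)).mul
    (AnalyticOnNhd.eval_polynomial _ y trivial)).div
    (AnalyticOnNhd.eval_polynomial _ y trivial) hq

theorem IsHypergeometric.isRiccatiSolutionOn (h : IsHypergeometric a b c q)
    (hs : ∀ y ∈ s, y ≠ 0 ∧ y ≠ 1 ∧ q.eval y ≠ 0) :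
    IsRiccatiSolutionOn a b c (weightedLogDeriv q) s := by
  intro y hy
  obtain ⟨hy0, hy1, hq⟩ := hs y hy
  refine ⟨hy0, hy1, analyticAt_weightedLogDeriv hq, ?_⟩
  filter_upwards [q.continuous.continuousAt.eventually_ne hq] with z hz
  rw [(hasDerivAt_weightedLogDeriv hz).deriv, weightedLogDeriv]
  field_simp
  linear_combination z * (1 - z) * q.eval z * h.eval_eq z

theorem eq_neg_natDegree_of_mul_derivative_eq {l₀ l₁ : ℝ} (hq : q ≠ 0)
    (h : X * (1 - X) * derivative q = (C l₀ + C l₁ * X) * q) : l₁ = -q.natDegree := by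
  set n := q.natDegree with hn
  have hexpand : X * derivative q - X * (X * derivative q) = C l₀ * q + C l₁ * (X * q) := by
    linear_combination h
  have htop : q.coeff (n + 1) = 0 := coeff_eq_zero_of_natDegree_lt n.lt_succ_self
  have hlead : q.coeff n ≠ 0 := leadingCoeff_ne_zero.2 hq
  have hcoeff : (X * derivative q).coeff n = n * q.coeff n := by
    rcases n with _ | n
    · simp
    · rw [coeff_X_mul, coeff_derivative]
      push_cast
      ring
  have hcmp := congrArg (fun p => p.coeff (n + 1)) hexpand
  simp only [coeff_add, coeff_sub, coeff_C_mul, coeff_X_mul, coeff_derivative, htop, hcoeff] at hcmp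
  refine mul_right_cancel₀ hlead ?_
  linear_combination -hcmp

theorem IsHypergeometric.neg_natDegree_eq (h : IsHypergeometric a b c q) (hq : q ≠ 0) :
    -(q.natDegree : ℝ) = a ∨ -(q.natDegree : ℝ) = b := by
  have htop := isHypergeometric_iff_coeff.1 h q.natDegree
  rw [coeff_eq_zero_of_natDegree_lt q.natDegree.lt_succ_self, mul_zero, eq_comm,
    coeff_natDegree, mul_eq_zero_iff_right (leadingCoeff_ne_zero.2 hq), mul_eq_zero] at htop
  exact htop.imp (fun h => by linear_combination -h) (fun h => by linear_combination -h)

theorem mul_derivative_eq_of_weightedLogDeriv_affine {l₀ l₁ : ℝ}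
    (h : {y | q.eval y ≠ 0 ∧ weightedLogDeriv q y = l₀ + l₁ * y}.Infinite) :
    X * (1 - X) * derivative q = (C l₀ + C l₁ * X) * q := by
  refine eq_of_infinite_eval_eq _ _ (h.mono ?_)
  rintro y ⟨hq, hy⟩
  rw [weightedLogDeriv, div_eq_iff hq] at hy
  simpa only [eval_add, eval_sub, eval_mul, eval_X, eval_one, eval_C, Set.mem_ofPred_eq] using hy

theorem IsHypergeometric.hasPVIRepresentation_of_mul_derivative_eq {l₀ l₁ : ℝ}
    (h : IsHypergeometric a b c q) (hs : ∀ y ∈ s, y ≠ 0 ∧ y ≠ 1 ∧ q.eval y ≠ 0)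
    (hq : q ≠ 0) (hl : X * (1 - X) * derivative q = (C l₀ + C l₁ * X) * q) :
    HasPVIRepresentation (cosgroveFun a b c (weightedLogDeriv q)) s := by
  have hs' : ∀ y ∈ s, y ≠ 0 ∧ y ≠ 1 := fun y hy => ⟨(hs y hy).1, (hs y hy).2.1⟩
  have hF : ∀ y ∈ s, weightedLogDeriv q y = l₀ + l₁ * y := by
    intro y hy
    rw [weightedLogDeriv, div_eq_iff (hs y hy).2.2]
    simpa only [eval_add, eval_sub, eval_mul, eval_X, eval_one, eval_C] using congrArg (eval y) hl
  have hl₁ := eq_neg_natDegree_of_mul_derivative_eq hq hl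
  obtain ⟨d, hd⟩ : ∃ d : ℝ, a * b - (a + b - 1) ^ 2 / 4 - l₁ = -(d ^ 2 / 4) := by
    rcases h.neg_natDegree_eq hq with ha | hb
    · exact ⟨b - a - 1, by rw [hl₁, ha]; ring⟩
    · exact ⟨a - b - 1, by rw [hl₁, hb]; ring⟩
  refine hasPVIRepresentation_of_affine
    (k := ((a + b) ^ 2 + 1 - c * (a + b + 1) - 2 * a * b) / 4 - l₀) (d := d) hs' fun y hy => ?_
  rw [cosgroveFun, hF y hy]
  linear_combination y * hd

theorem IsHypergeometric.hasPVIRepresentation (h : IsHypergeometric a b c q) (ha : a ≠ 1)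
    (hs : ∀ y ∈ s, y ≠ 0 ∧ y ≠ 1 ∧ q.eval y ≠ 0) :
    HasPVIRepresentation (cosgroveFun a b c (weightedLogDeriv q)) s := by
  set u := pviFun a b c (weightedLogDeriv q) with hu
  by_cases haffine : ∃ e₀ e₁ : ℝ, {y ∈ s | u y = e₀ + e₁ * y}.Infinite
  · obtain ⟨e₀, e₁, hinf⟩ := haffine
    obtain ⟨y₀, hy₀, -⟩ := hinf.nonempty
    have hq : q ≠ 0 := fun hq => (hs y₀ hy₀).2.2 (hq ▸ eval_zero)
    refine h.hasPVIRepresentation_of_mul_derivative_eq hs hq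
      (mul_derivative_eq_of_weightedLogDeriv_affine (l₀ := 1 - c - (1 - a) * e₀)
        (l₁ := b - (1 - a) * e₁) (hinf.mono ?_))
    rintro y ⟨hy, huy⟩
    refine ⟨(hs y hy).2.2, ?_⟩
    rw [eq_sub_mul_pviFun (F := weightedLogDeriv q) (b := b) (c := c) ha, ← hu, huy]
    ring
  · push Not at haffine
    refine (h.isRiccatiSolutionOn hs).hasPVIRepresentation ha
      (((haffine 0 0).union ((haffine 1 0).union (haffine 0 1))).subset ?_)
    rintro y ⟨hy, h0 | h1 | hid⟩
    · exact .inl ⟨hy, by linear_combination h0⟩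
    · exact .inr (.inl ⟨hy, by linear_combination h1⟩)
    · exact .inr (.inr ⟨hy, by linear_combination hid⟩)

end Hypergeometric

section Jacobi

variable (n : ℕ) (a b : ℝ)

/-- The coefficient of `((x-1)/2)^k` in the Jacobi polynomial `P_n^{(a,b)}`. -/
def jacobiCoeff (k : ℕ) : ℝ :=
  (ascPochhammer ℝ k).eval (n + a + b + 1) * (ascPochhammer ℝ (n - k)).eval (a + k + 1)
    / ((k.factorial : ℝ) * ((n - k).factorial : ℝ))

theorem jacobiCoeff_succ {k : ℕ} (hk : k < n) :
    (k + 1) * (k + a + 1) * jacobiCoeff n a b (k + 1) =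
      (n - k) * (n + k + a + b + 1) * jacobiCoeff n a b k := by
  obtain ⟨j, rfl⟩ := Nat.exists_eq_add_of_lt hk
  have hsub : k + j + 1 - k = j + 1 := by lia
  have hsub' : k + j + 1 - (k + 1) = j := by lia
  have hshift : (X + 1 : ℝ[X]).eval (a + k + 1) = a + ((k + 1 : ℕ) : ℝ) + 1 := by
    rw [eval_add, eval_X, eval_one]
    push_cast
    ring
  rw [jacobiCoeff, jacobiCoeff, hsub, hsub', ascPochhammer_succ_eval, ascPochhammer_succ_left,
    eval_mul, eval_X, eval_comp, hshift, Nat.factorial_succ, Nat.factorial_succ]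
  push_cast
  field_simp
  ring

/-- The Jacobi polynomial `P_n^{(a,b)}` in the variable `y = (1-x)/2`, in which its differential
equation is the hypergeometric one. -/
def shiftedJacobi : ℝ[X] := (jacobiPoly n a b).comp (1 - C 2 * X)

theorem eval_shiftedJacobi (y : ℝ) :
    (shiftedJacobi n a b).eval y = (jacobiPoly n a b).eval (1 - 2 * y) := by
  simp only [shiftedJacobi, eval_comp, eval_sub, eval_mul, eval_one, eval_C, eval_X]

theorem eval_derivative_shiftedJacobi (y : ℝ) :
    (shiftedJacobi n a b).derivative.eval y =
      -2 * (jacobiPoly n a b).derivative.eval (1 - 2 * y) := by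
  simp [shiftedJacobi, derivative_comp]

theorem eval_derivative_derivative_shiftedJacobi (y : ℝ) :
    (shiftedJacobi n a b).derivative.derivative.eval y =
      4 * (jacobiPoly n a b).derivative.derivative.eval (1 - 2 * y) := by
  simp only [shiftedJacobi, derivative_comp, derivative_sub, derivative_one, derivative_mul,
    derivative_C, zero_mul, derivative_X, mul_one, zero_add, zero_sub, neg_mul, derivative_neg,
    mul_neg, neg_neg, eval_mul, eval_C, eval_comp, eval_sub, eval_one, eval_X]
  ring

theorem shiftedJacobi_eq_sum :
    shiftedJacobi n a b =
      ∑ k ∈ Finset.range (n + 1), C ((-1) ^ k * jacobiCoeff n a b k) * X ^ k := by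
  rw [shiftedJacobi, jacobiPoly, sum_comp]
  refine Finset.sum_congr rfl fun k _ => ?_
  have hX : C (1 / 2 : ℝ) * (1 - C (2 : ℝ) * X - 1) = C (-1) * X := by
    rw [sub_sub_cancel_left, mul_neg, ← mul_assoc, ← C_mul]
    norm_num
  simp only [mul_comp, C_comp, pow_comp, sub_comp, X_comp, one_comp]
  rw [hX, mul_pow, ← C_pow, ← mul_assoc, ← C_mul, mul_comm (_ / _), jacobiCoeff]

theorem coeff_shiftedJacobi (k : ℕ) :
    (shiftedJacobi n a b).coeff k = if k < n + 1 then (-1) ^ k * jacobiCoeff n a b k else 0 := by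
  simp only [shiftedJacobi_eq_sum, finsetSum_coeff, coeff_C_mul, coeff_X_pow, mul_ite, mul_one,
    mul_zero, Finset.sum_ite_eq, Finset.mem_range]

theorem isHypergeometric_shiftedJacobi :
    IsHypergeometric (-n) (n + a + b + 1) (a + 1) (shiftedJacobi n a b) := by
  refine isHypergeometric_iff_coeff.2 fun k => ?_
  rw [coeff_shiftedJacobi, coeff_shiftedJacobi]
  rcases lt_trichotomy k n with h | rfl | h
  · rw [if_pos (by lia), if_pos (by lia), pow_succ]
    linear_combination (-(-1) ^ k) * jacobiCoeff_succ n a b h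
  · rw [if_neg (by lia), mul_zero, add_neg_cancel, zero_mul, zero_mul]
  · rw [if_neg (by lia), if_neg (by lia), mul_zero, mul_zero]

variable {n a b}

theorem coeff_shiftedJacobi_self_ne_zero (h : (ascPochhammer ℝ n).eval (n + a + b + 1) ≠ 0) :
    (shiftedJacobi n a b).coeff n ≠ 0 := by
  rw [coeff_shiftedJacobi, if_pos n.lt_succ_self, jacobiCoeff, Nat.sub_self, ascPochhammer_zero,
    eval_one]
  positivity

theorem natDegree_shiftedJacobi (h : (ascPochhammer ℝ n).eval (n + a + b + 1) ≠ 0) :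
    (shiftedJacobi n a b).natDegree = n := by
  refine natDegree_eq_of_le_of_coeff_ne_zero (natDegree_le_iff_coeff_eq_zero.2 fun k hk => ?_)
    (coeff_shiftedJacobi_self_ne_zero h)
  rw [coeff_shiftedJacobi, if_neg (by lia)]

theorem shiftedJacobi_ne_zero (h : (ascPochhammer ℝ n).eval (n + a + b + 1) ≠ 0) :
    shiftedJacobi n a b ≠ 0 :=
  fun h0 => coeff_shiftedJacobi_self_ne_zero h (by rw [h0, coeff_zero])

theorem jacobiPoly_ode (x : ℝ) :
    (1 - x ^ 2) * (jacobiPoly n a b).derivative.derivative.eval x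
      + (b - a - (a + b + 2) * x) * (jacobiPoly n a b).derivative.eval x
      + n * (n + a + b + 1) * (jacobiPoly n a b).eval x = 0 := by
  have h := (isHypergeometric_shiftedJacobi n a b).eval_eq ((1 - x) / 2)
  rw [eval_shiftedJacobi, eval_derivative_shiftedJacobi,
    eval_derivative_derivative_shiftedJacobi, show 1 - 2 * ((1 - x) / 2) = x by ring] at h
  linear_combination h

end Jacobi

section AngularOperator

variable {m : ℕ} {α β x : ℝ}

theorem logDeriv_rpow_const {f : ℝ → ℝ} (hf : DifferentiableAt ℝ f x) (hx : 0 < f x) (p : ℝ) :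
    logDeriv (fun z => f z ^ p) x = p * logDeriv f x := by
  rw [logDeriv_apply, logDeriv_apply, (hf.hasDerivAt.rpow_const (.inl hx.ne')).deriv,
    Real.rpow_sub_one hx.ne']
  have := Real.rpow_pos_of_pos hx p
  field_simp

theorem superpotential_eq (hx : x ∈ Set.Ioo (-1) 1) (hP : (seedPoly m α β).eval x ≠ 0) :
    superpotential m α β x = -((β / 2 - 1 / 4) / (1 + x) + (α / 2 + 1 / 4) / (1 - x)
      + (seedPoly m α β).derivative.eval x / (seedPoly m α β).eval x) := by
  have hx0 : 0 < 1 + x := by linarith [hx.1]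
  have hx1 : 0 < 1 - x := by linarith [hx.2]
  have hd0 : HasDerivAt (fun z : ℝ => 1 + z) 1 x := (hasDerivAt_id' x).const_add 1
  have hd1 : HasDerivAt (fun z : ℝ => 1 - z) (-1) x := (hasDerivAt_id' x).const_sub 1
  have hw0 := (Real.rpow_pos_of_pos hx0 (β / 2 - 1 / 4)).ne'
  have hw1 := (Real.rpow_pos_of_pos hx1 (-α / 2 - 1 / 4)).ne'
  have hdw0 := hd0.differentiableAt.rpow_const (p := β / 2 - 1 / 4) (.inl hx0.ne')
  have hdw1 := hd1.differentiableAt.rpow_const (p := -α / 2 - 1 / 4) (.inl hx1.ne')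
  have hlog : logDeriv (seed m α β) x =
      (β / 2 - 1 / 4) * logDeriv (1 + ·) x + (-α / 2 - 1 / 4) * logDeriv (1 - ·) x
        + logDeriv (fun z => (seedPoly m α β).eval z) x := by
    rw [← logDeriv_rpow_const hd0.differentiableAt hx0,
      ← logDeriv_rpow_const hd1.differentiableAt hx1, ← logDeriv_mul x hw0 hw1 hdw0 hdw1]
    exact logDeriv_mul x (mul_ne_zero hw0 hw1) hP (hdw0.mul hdw1) (seedPoly m α β).differentiableAt
  rw [superpotential, hlog, logDeriv_apply, logDeriv_apply, logDeriv_apply, hd0.deriv, hd1.deriv,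
    Polynomial.deriv]
  ring

theorem hasDerivAt_superpotential (hx : x ∈ Set.Ioo (-1) 1) (hP : (seedPoly m α β).eval x ≠ 0) :
    HasDerivAt (superpotential m α β) ((β / 2 - 1 / 4) / (1 + x) ^ 2
      - (α / 2 + 1 / 4) / (1 - x) ^ 2
      - ((seedPoly m α β).derivative.derivative.eval x * (seedPoly m α β).eval x
          - (seedPoly m α β).derivative.eval x ^ 2) / (seedPoly m α β).eval x ^ 2) x := by
  have hx0 : 1 + x ≠ 0 := by linarith [hx.1]
  have hx1 : 1 - x ≠ 0 := by linarith [hx.2]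
  have hd := ((((hasDerivAt_const x (β / 2 - 1 / 4)).div
    ((hasDerivAt_id' x).const_add 1) hx0).add ((hasDerivAt_const x (α / 2 + 1 / 4)).div
    ((hasDerivAt_id' x).const_sub 1) hx1)).add (((seedPoly m α β).derivative.hasDerivAt x).div
    ((seedPoly m α β).hasDerivAt x) hP)).neg
  refine (hd.congr_of_eventuallyEq ?_).congr_deriv (by ring)
  filter_upwards [isOpen_Ioo.mem_nhds hx,
    (seedPoly m α β).continuous.continuousAt.eventually_ne hP] with z hz hzP
    using superpotential_eq hz hzP

/-- The function of `x = -cos 2θ` which, divided by `r²`, is the angular part of the potential; it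
is half of the zeroth order term of the angular operator. -/
def angularPotential (m : ℕ) (α β x : ℝ) : ℝ :=
  2 * (1 - x ^ 2) * (deriv (superpotential m α β) x + superpotential m α β x ^ 2)
    - 2 * x * superpotential m α β x + (2 * m - α + β - 1) ^ 2 / 2

theorem angularOp_eq {f : ℝ → ℝ} (hx : x ∈ Set.Ioo (-1) 1) (hP : (seedPoly m α β).eval x ≠ 0)
    (hf : DifferentiableAt ℝ f x) (hf' : DifferentiableAt ℝ (deriv f) x) :
    angularOp m α β f x = -4 * (1 - x ^ 2) * deriv (deriv f) x + 4 * x * deriv f x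
      + 2 * angularPotential m α β x * f x := by
  have hpos : 0 < 1 - x ^ 2 := by nlinarith [hx.1, hx.2]
  have hsqrt := (((hasDerivAt_id' x).pow 2).const_sub 1).sqrt hpos.ne'
  have hw := (hasDerivAt_superpotential hx hP).differentiableAt.hasDerivAt
  have hAdag : deriv (opAdag m α β f) x = _ :=
    ((hsqrt.const_mul 2).mul (hf'.hasDerivAt.neg.add (hw.mul hf.hasDerivAt))).deriv
  rw [angularOp, opA, hAdag, opAdag, angularPotential]
  simp only [Pi.mul_apply, Pi.add_apply, Pi.neg_apply, Pi.pow_apply]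
  have hsq : √(1 - x ^ 2) ^ 2 = 1 - x ^ 2 := Real.sq_sqrt hpos.le
  have hne : √(1 - x ^ 2) ≠ 0 := (Real.sqrt_pos.2 hpos).ne'
  generalize √(1 - x ^ 2) = v at *
  rw [← hsq]
  field_simp
  push_cast
  ring

-- The Darboux transformation turns the Pöschl–Teller potential with parameters `α + 1`, `β - 1`
-- into the one with parameters `α`, `β`, up to derivatives of `ln P_m`.
theorem angularPotential_eq (hx : x ∈ Set.Ioo (-1) 1) (hP : (seedPoly m α β).eval x ≠ 0) :
    angularPotential m α β x = (α ^ 2 - 1 / 4) / (1 - x) + (β ^ 2 - 1 / 4) / (1 + x)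
      + 4 * x * ((seedPoly m α β).derivative.eval x / (seedPoly m α β).eval x)
      - 4 * (1 - x ^ 2) * (((seedPoly m α β).derivative.derivative.eval x
          * (seedPoly m α β).eval x - (seedPoly m α β).derivative.eval x ^ 2)
            / (seedPoly m α β).eval x ^ 2) := by
  have hx0 : 1 + x ≠ 0 := by linarith [hx.1]
  have hx1 : 1 - x ≠ 0 := by linarith [hx.2]
  have hode : (1 - x ^ 2) * (seedPoly m α β).derivative.derivative.eval x
      + (β + α - (β - α) * x) * (seedPoly m α β).derivative.eval x
      + m * (m + β - α - 1) * (seedPoly m α β).eval x = 0 := by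
    have h := jacobiPoly_ode (n := m) (a := -α - 1) (b := β - 1) x
    rw [← seedPoly] at h
    linear_combination h
  rw [angularPotential, (hasDerivAt_superpotential hx hP).deriv, superpotential_eq hx hP]
  generalize (seedPoly m α β).eval x = p at *
  field_simp
  linear_combination (64 * p * (1 - x ^ 2) ^ 2) * hode

theorem exists_angularPotential_eq_eval_div (m : ℕ) (α β : ℝ) :
    ∃ N : ℝ[X], ∀ x ∈ Set.Ioo (-1 : ℝ) 1, (seedPoly m α β).eval x ≠ 0 →
      angularPotential m α β x = N.eval x / ((1 - x ^ 2) * (seedPoly m α β).eval x ^ 2) := by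
  set P := seedPoly m α β with hPdef
  refine ⟨(C (α ^ 2 - 1 / 4) * (1 + X) + C (β ^ 2 - 1 / 4) * (1 - X)) * P ^ 2
    + (1 - X ^ 2) * (4 * X * derivative P * P
      - 4 * (1 - X ^ 2) * (derivative (derivative P) * P - derivative P ^ 2)), ?_⟩
  intro x hx hP
  have hx0 : 1 + x ≠ 0 := by linarith [hx.1]
  have hx1 : 1 - x ≠ 0 := by linarith [hx.2]
  have hx2 : 1 - x ^ 2 ≠ 0 := by
    rw [show 1 - x ^ 2 = (1 + x) * (1 - x) by ring]
    exact mul_ne_zero hx0 hx1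
  rw [angularPotential_eq hx hP, ← hPdef]
  simp only [eval_add, eval_sub, eval_mul, eval_pow, eval_X, eval_one, eval_C, eval_ofNat]
  field_simp
  ring

end AngularOperator

section Hamiltonian

variable {m : ℕ} {α β ω r θ : ℝ}

theorem neg_cos_two_mul_mem_Ioo (h₀ : 0 < θ) (h₁ : θ < Real.pi / 2) :
    -Real.cos (2 * θ) ∈ Set.Ioo (-1) 1 := by
  have hsin : 0 < Real.sin (2 * θ) :=
    Real.sin_pos_of_pos_of_lt_pi (by linarith) (by linarith)
  constructor <;> nlinarith [Real.sin_sq_add_cos_sq (2 * θ), pow_pos hsin 2]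

theorem potential_eq (hθ : θ ∈ regularAngles m α β) :
    potential ω m α β r θ = ω ^ 2 * r ^ 2 / 2
      + 1 / r ^ 2 * angularPotential m α β (-Real.cos (2 * θ)) := by
  rw [potential, hamiltonian, angularOp_eq (neg_cos_two_mul_mem_Ioo hθ.1 hθ.2.1) hθ.2.2
    (differentiableAt_const 1) (by simp)]
  simp only [deriv_const', mul_zero]
  ring

theorem differentiableAt_deriv_of_contDiffAt {f : ℝ → ℝ} {x : ℝ} (hf : ContDiffAt ℝ 2 f x) :
    DifferentiableAt ℝ (deriv f) x :=
  (hf.derivWithin (m := 1) (by norm_num)).differentiableAt (by simp)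

theorem deriv_id_mul_deriv {f : ℝ → ℝ} {x : ℝ} (hf : DifferentiableAt ℝ (deriv f) x) :
    deriv (fun z => z * deriv f z) x = deriv f x + x * deriv (deriv f) x :=
  (((hasDerivAt_id' x).mul hf.hasDerivAt).congr_deriv (by rw [one_mul])).deriv

theorem hasDerivAt_neg_cos_two_mul (θ : ℝ) :
    HasDerivAt (fun t => -Real.cos (2 * t)) (2 * Real.sin (2 * θ)) θ :=
  ((hasDerivAt_id' θ).const_mul 2).cos.neg.congr_deriv (by ring)

theorem deriv_deriv_comp_neg_cos_two_mul {g : ℝ → ℝ}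
    (hg : ContDiffAt ℝ 2 g (-Real.cos (2 * θ))) :
    deriv (deriv fun t => g (-Real.cos (2 * t))) θ =
      4 * (1 - Real.cos (2 * θ) ^ 2) * deriv (deriv g) (-Real.cos (2 * θ))
        + 4 * Real.cos (2 * θ) * deriv g (-Real.cos (2 * θ)) := by
  have hx := hasDerivAt_neg_cos_two_mul
  have hsin : HasDerivAt (fun t => 2 * Real.sin (2 * t)) (4 * Real.cos (2 * θ)) θ :=
    (((hasDerivAt_id' θ).const_mul 2).sin.const_mul 2).congr_deriv (by ring)
  have hfirst : deriv (fun t => g (-Real.cos (2 * t))) =ᶠ[𝓝 θ]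
      fun t => deriv g (-Real.cos (2 * t)) * (2 * Real.sin (2 * t)) := by
    filter_upwards [(hx θ).continuousAt.eventually (hg.eventually (by simp))] with t ht
    exact ((ht.differentiableAt (by simp)).hasDerivAt.comp t (hx t)).deriv
  have hsecond :=
    ((differentiableAt_deriv_of_contDiffAt hg).hasDerivAt.comp θ (hx θ)).mul hsin
  rw [hfirst.deriv_eq, ← Real.sin_sq]
  refine hsecond.deriv.trans ?_
  rw [Function.comp_apply]
  ring

theorem hamiltonian_eq {Ψ : ℝ → ℝ → ℝ} (hr : r ≠ 0) (hθ : θ ∈ regularAngles m α β)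
    (hΨ : ContDiffAt ℝ 2 (fun p : ℝ × ℝ => Ψ p.1 p.2) (r, -Real.cos (2 * θ))) :
    hamiltonian ω m α β Ψ r (-Real.cos (2 * θ)) =
      -(1 / 2) * polarLaplacian (fun s t => Ψ s (-Real.cos (2 * t))) r θ
        + potential ω m α β r θ * Ψ r (-Real.cos (2 * θ)) := by
  have hangular : ContDiffAt ℝ 2 (Ψ r) (-Real.cos (2 * θ)) :=
    hΨ.comp (f := fun x : ℝ => (r, x)) _ (contDiffAt_const.prodMk contDiffAt_id)
  have hradial : ContDiffAt ℝ 2 (fun s => Ψ s (-Real.cos (2 * θ))) r :=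
    hΨ.comp (f := fun s : ℝ => (s, -Real.cos (2 * θ))) _ (contDiffAt_id.prodMk contDiffAt_const)
  rw [potential_eq hθ, hamiltonian, polarLaplacian, deriv_deriv_comp_neg_cos_two_mul hangular,
    deriv_id_mul_deriv (differentiableAt_deriv_of_contDiffAt hradial),
    angularOp_eq (neg_cos_two_mul_mem_Ioo hθ.1 hθ.2.1) hθ.2.2
      (hangular.differentiableAt (by simp)) (differentiableAt_deriv_of_contDiffAt hangular)]
  field_simp
  ring

end Hamiltonian

section CosgroveSolution

variable {m : ℕ} {α β θ y : ℝ}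

/-- The seed polynomial in the variable `y = (1-x)/2`. -/
def shiftedSeed (m : ℕ) (α β : ℝ) : ℝ[X] := shiftedJacobi m (-α - 1) (β - 1)

theorem eval_shiftedSeed (m : ℕ) (α β y : ℝ) :
    (shiftedSeed m α β).eval y = (seedPoly m α β).eval (1 - 2 * y) :=
  eval_shiftedJacobi m (-α - 1) (β - 1) y

theorem isHypergeometric_shiftedSeed (m : ℕ) (α β : ℝ) :
    IsHypergeometric (-m) (m + β - α - 1) (-α) (shiftedSeed m α β) := by
  have h := isHypergeometric_shiftedJacobi m (-α - 1) (β - 1)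
  rwa [show m + (-α - 1) + (β - 1) + 1 = m + β - α - 1 by ring, sub_add_cancel] at h

theorem ne_zero_and_ne_one_and_eval_shiftedSeed_ne_zero :
    ∀ y ∈ regularPoints m α β, y ≠ 0 ∧ y ≠ 1 ∧ (shiftedSeed m α β).eval y ≠ 0 :=
  fun y hy => ⟨hy.1.ne', hy.2.1.ne, by rw [eval_shiftedSeed]; exact hy.2.2⟩

theorem angularPotential_one_sub_two_mul (hy : y ∈ regularPoints m α β) :
    angularPotential m α β (1 - 2 * y) =
      (α ^ 2 - 1 / 4) / (2 * y) + (β ^ 2 - 1 / 4) / (2 * (1 - y))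
        - 4 * deriv (weightedLogDeriv (shiftedSeed m α β)) y
        - 2 * (2 * y - 1) * weightedLogDeriv (shiftedSeed m α β) y / (y * (1 - y)) := by
  obtain ⟨hy0, hy1, hP⟩ := hy
  have hq := hP
  rw [← eval_shiftedSeed] at hq
  have hz0 : 1 - y ≠ 0 := by linarith
  rw [angularPotential_eq ⟨by linarith, by linarith⟩ hP, (hasDerivAt_weightedLogDeriv hq).deriv,
    weightedLogDeriv, shiftedSeed, eval_shiftedJacobi, eval_derivative_shiftedJacobi,
    eval_derivative_derivative_shiftedJacobi, ← seedPoly]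
  rw [show 1 - (1 - 2 * y) = 2 * y by ring, show 1 + (1 - 2 * y) = 2 * (1 - y) by ring]
  field_simp
  ring

/-- The numerator of the rational function `cosgroveFun a b c (weightedLogDeriv q)` over the
denominator `q`. -/
def cosgroveNumerator (a b c : ℝ) (q : ℝ[X]) : ℝ[X] :=
  (C (((a + b) ^ 2 + 1 - c * (a + b + 1) - 2 * a * b) / 4)
    + C (a * b - (a + b - 1) ^ 2 / 4) * X) * q - X * (1 - X) * derivative q

theorem cosgroveFun_weightedLogDeriv {q : ℝ[X]} (hq : q.eval y ≠ 0) (a b c : ℝ) :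
    cosgroveFun a b c (weightedLogDeriv q) y = (cosgroveNumerator a b c q).eval y / q.eval y := by
  rw [cosgroveFun, weightedLogDeriv, cosgroveNumerator]
  simp only [eval_sub, eval_add, eval_mul, eval_C, eval_X, eval_one]
  field_simp

theorem hasDerivAt_angularPrimitive {κ W' : ℝ} {W : ℝ → ℝ} (hs : Real.sin θ ≠ 0)
    (hc : Real.cos θ ≠ 0) (hW : HasDerivAt W W' ((1 + Real.cos (2 * θ)) / 2)) :
    HasDerivAt (angularPrimitive κ W)
      (4 * W' + (2 * Real.cos (2 * θ) * W ((1 + Real.cos (2 * θ)) / 2) + κ / 2)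
        / (Real.sin θ * Real.cos θ) ^ 2) θ := by
  have hsin : Real.sin (2 * θ) = 2 * Real.sin θ * Real.cos θ := Real.sin_two_mul θ
  have hsin0 : Real.sin (2 * θ) ≠ 0 := by rw [hsin]; positivity
  have hdcos := ((hasDerivAt_id' θ).const_mul 2).cos
  have hdW := hW.comp θ ((hdcos.const_add 1).div_const 2)
  have hdcot := (hdcos.div ((hasDerivAt_id' θ).const_mul 2).sin hsin0).const_mul κ
  have hd := ((hdW.const_mul (-2)).div ((Real.hasDerivAt_sin θ).mul (Real.hasDerivAt_cos θ))
    (mul_ne_zero hs hc)).sub hdcot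
  refine hd.congr_deriv ?_
  simp only [Function.comp_apply, Pi.mul_apply]
  generalize W ((1 + Real.cos (2 * θ)) / 2) = w
  rw [hsin, Real.cos_two_mul']
  have hone := Real.sin_sq_add_cos_sq θ
  field_simp
  linear_combination κ * (Real.sin θ ^ 2 + Real.cos θ ^ 2 + 1) * hone

/-- The rational function `W` of `y = (1-x)/2` that solves SD-I.a and from which the potential is
obtained. At the zeros of the denominator it takes the value `0`, unlike `cosgroveFun`. -/
def cosgroveSolution (m : ℕ) (α β y : ℝ) : ℝ :=
  (cosgroveNumerator (-m) (m + β - α - 1) (-α) (shiftedSeed m α β)).eval y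
    / (seedPoly m α β).eval (1 - 2 * y)

theorem cosgroveSolution_eq (hy : y ∈ regularPoints m α β) :
    cosgroveSolution m α β y =
      cosgroveFun (-m) (m + β - α - 1) (-α) (weightedLogDeriv (shiftedSeed m α β)) y := by
  rw [cosgroveSolution, ← eval_shiftedSeed]
  exact (cosgroveFun_weightedLogDeriv (ne_zero_and_ne_one_and_eval_shiftedSeed_ne_zero y hy).2.2
    _ _ _).symm

theorem isOpen_regularPoints (m : ℕ) (α β : ℝ) : IsOpen (regularPoints m α β) := by
  have hcont : Continuous fun y => (seedPoly m α β).eval (1 - 2 * y) := by fun_prop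
  exact (isOpen_lt continuous_const continuous_id).inter
    ((isOpen_lt continuous_id continuous_const).inter (isOpen_ne_fun hcont continuous_const))

theorem cosgroveSolution_eventuallyEq (hy : y ∈ regularPoints m α β) :
    cosgroveSolution m α β =ᶠ[𝓝 y]
      cosgroveFun (-m) (m + β - α - 1) (-α) (weightedLogDeriv (shiftedSeed m α β)) :=
  ((isOpen_regularPoints m α β).eventually_mem hy).mono fun _ => cosgroveSolution_eq

theorem exists_isSDIaSolutionOn_cosgroveSolution (m : ℕ) (α β : ℝ) :
    ∃ q₇ q₈ q₉ q₁₀ : ℝ,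
      IsSDIaSolutionOn q₇ q₈ q₉ q₁₀ (cosgroveSolution m α β) (regularPoints m α β) :=
  ⟨_, _, _, _, (((isHypergeometric_shiftedSeed m α β).isRiccatiSolutionOn
    ne_zero_and_ne_one_and_eval_shiftedSeed_ne_zero).isSDIaSolutionOn rfl rfl rfl).congr
    fun _ => cosgroveSolution_eventuallyEq⟩

theorem hasPVIRepresentation_cosgroveSolution (m : ℕ) (α β : ℝ) :
    HasPVIRepresentation (cosgroveSolution m α β) (regularPoints m α β) := by
  have hm : -(m : ℝ) ≠ 1 := by linarith [m.cast_nonneg (α := ℝ)]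
  exact ((isHypergeometric_shiftedSeed m α β).hasPVIRepresentation hm
    ne_zero_and_ne_one_and_eval_shiftedSeed_ne_zero).congr fun _ => cosgroveSolution_eq

theorem mem_regularPoints_of_mem_regularAngles (hθ : θ ∈ regularAngles m α β) :
    (1 + Real.cos (2 * θ)) / 2 ∈ regularPoints m α β := by
  obtain ⟨hlt, hgt⟩ := neg_cos_two_mul_mem_Ioo hθ.1 hθ.2.1
  refine ⟨by linarith, by linarith, ?_⟩
  rw [show 1 - 2 * ((1 + Real.cos (2 * θ)) / 2) = -Real.cos (2 * θ) by ring]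
  exact hθ.2.2

theorem hasDerivAt_angularPrimitive_cosgroveSolution (hθ : θ ∈ regularAngles m α β) :
    HasDerivAt (angularPrimitive (cotCoeff m α β) (cosgroveSolution m α β))
      (angularPotential m α β (-Real.cos (2 * θ))) θ := by
  have hy := mem_regularPoints_of_mem_regularAngles hθ
  have hF := (hasDerivAt_weightedLogDeriv
    (ne_zero_and_ne_one_and_eval_shiftedSeed_ne_zero _ hy).2.2).differentiableAt.hasDerivAt
  have hW := (hasDerivAt_cosgroveFun hF).congr_of_eventuallyEq (cosgroveSolution_eventuallyEq hy)
  have hs : Real.sin θ ≠ 0 :=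
    (Real.sin_pos_of_pos_of_lt_pi hθ.1 (by linarith [hθ.2.1, Real.pi_pos])).ne'
  have hc : Real.cos θ ≠ 0 :=
    (Real.cos_pos_of_mem_Ioo ⟨by linarith [hθ.1, Real.pi_pos], hθ.2.1⟩).ne'
  refine (hasDerivAt_angularPrimitive hs hc hW).congr_deriv ?_
  have hsc : (Real.sin θ * Real.cos θ) ^ 2 =
      (1 + Real.cos (2 * θ)) / 2 * (1 - (1 + Real.cos (2 * θ)) / 2) := by
    rw [mul_pow, Real.sin_sq, Real.cos_sq]
    ring
  have hcos : Real.cos (2 * θ) = 2 * ((1 + Real.cos (2 * θ)) / 2) - 1 := by ring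
  rw [hsc]
  generalize (1 + Real.cos (2 * θ)) / 2 = y at *
  have hy0 : y ≠ 0 := hy.1.ne'
  have hy1 : 1 - y ≠ 0 := by linarith [hy.2.1]
  rw [hcos, show -(2 * y - 1) = 1 - 2 * y by ring, angularPotential_one_sub_two_mul hy,
    cosgroveSolution_eq hy, cosgroveFun, cotCoeff]
  field_simp
  ring

end CosgroveSolution

section Distinctness

variable {p q : ℝ[X]}

theorem wronskian_eq_zero_of_infinite (hp : p ≠ 0) (hq : q ≠ 0)
    (h : {y | y ≠ 0 ∧ y ≠ 1 ∧ p.eval y ≠ 0 ∧ q.eval y ≠ 0 ∧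
      deriv (weightedLogDeriv p) y + (2 * y - 1) * weightedLogDeriv p y / (2 * y * (1 - y)) =
        deriv (weightedLogDeriv q) y
          + (2 * y - 1) * weightedLogDeriv q y / (2 * y * (1 - y))}.Infinite) :
    wronskian p q = 0 := by
  have hident : (1 - 2 * X) * wronskian p q * (p * q)
      + 2 * X * (1 - X) * (derivative (wronskian p q) * (p * q)
        - wronskian p q * derivative (p * q)) = 0 := by
    refine eq_of_infinite_eval_eq _ _ (h.mono ?_)
    rintro y ⟨hy0, hy1, hpy, hqy, hy⟩
    rw [(hasDerivAt_weightedLogDeriv hpy).deriv, (hasDerivAt_weightedLogDeriv hqy).deriv,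
      weightedLogDeriv, weightedLogDeriv] at hy
    have hz : 1 - y ≠ 0 := sub_ne_zero.2 hy1.symm
    simp only [wronskian, derivative_sub, derivative_mul, Set.mem_ofPred_eq, eval_add, eval_mul,
      eval_sub, eval_X, eval_one, eval_ofNat, eval_zero]
    field_simp at hy
    linear_combination -hy
  have hw := wronskian_X_mul_one_sub_X_mul_sq (wronskian p q) (p * q)
  rw [hident, mul_zero, neg_zero] at hw
  have hpq := mul_ne_zero hp hq
  obtain ⟨k, hk⟩ := exists_eq_C_mul_of_wronskian_eq_zero (pow_ne_zero 2 hpq) hw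
  exact eq_zero_of_mul_sq_eq_C_mul_sq (r := 0)
    (by rw [rootMultiplicity_zero_X_mul_one_sub_X]; exact odd_one) hk

end Distinctness

section GenericParameters

variable {m n : ℕ} {α β y : ℝ}

theorem ascPochhammer_eval_ne_zero_of_forall_sub_ne_intCast (h : ∀ k : ℤ, α - β ≠ k) (m : ℕ) :
    (ascPochhammer ℝ m).eval (m + (-α - 1) + (β - 1) + 1) ≠ 0 := by
  rw [Ne, ascPochhammer_eval_eq_zero_iff]
  rintro ⟨k, _, hk⟩
  apply h (m - 1 + k)
  push_cast
  linear_combination -hk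

theorem shiftedSeed_ne_zero (h : ∀ k : ℤ, α - β ≠ k) (m : ℕ) : shiftedSeed m α β ≠ 0 :=
  shiftedJacobi_ne_zero (ascPochhammer_eval_ne_zero_of_forall_sub_ne_intCast h m)

theorem natDegree_shiftedSeed (h : ∀ k : ℤ, α - β ≠ k) (m : ℕ) :
    (shiftedSeed m α β).natDegree = m :=
  natDegree_shiftedJacobi (ascPochhammer_eval_ne_zero_of_forall_sub_ne_intCast h m)

theorem seedPoly_ne_zero (h : ∀ k : ℤ, α - β ≠ k) (m : ℕ) : seedPoly m α β ≠ 0 := fun h0 =>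
  shiftedSeed_ne_zero h m (Polynomial.funext fun y => by rw [eval_shiftedSeed, h0, eval_zero,
    eval_zero])

theorem infinite_regularPoints_inter (hm : shiftedSeed m α β ≠ 0) (hn : shiftedSeed n α β ≠ 0) :
    (regularPoints m α β ∩ regularPoints n α β).Infinite := by
  refine ((Set.Ioo_infinite zero_lt_one).sdiff
    ((finite_setOfPred_isRoot hm).union (finite_setOfPred_isRoot hn))).mono ?_
  rintro y ⟨⟨hy0, hy1⟩, hy⟩
  simp only [Set.mem_union, Set.mem_ofPred_eq, IsRoot.def, not_or, eval_shiftedSeed] at hy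
  exact ⟨⟨hy0, hy1, hy.1⟩, hy0, hy1, hy.2⟩

theorem exists_angularPotential_ne (h : ∀ k : ℤ, α - β ≠ k) (hmn : m ≠ n) :
    ∃ y ∈ regularPoints m α β ∩ regularPoints n α β,
      angularPotential m α β (1 - 2 * y) ≠ angularPotential n α β (1 - 2 * y) := by
  have hp := shiftedSeed_ne_zero h m
  have hq := shiftedSeed_ne_zero h n
  by_contra! heq
  have hwronskian : wronskian (shiftedSeed m α β) (shiftedSeed n α β) = 0 := by
    refine wronskian_eq_zero_of_infinite hp hq ((infinite_regularPoints_inter hp hq).mono ?_)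
    intro y hy
    obtain ⟨hy0, hy1, hpy⟩ := ne_zero_and_ne_one_and_eval_shiftedSeed_ne_zero y hy.1
    refine ⟨hy0, hy1, hpy, (ne_zero_and_ne_one_and_eval_shiftedSeed_ne_zero y hy.2).2.2, ?_⟩
    have hV := heq y hy
    rw [angularPotential_one_sub_two_mul hy.1, angularPotential_one_sub_two_mul hy.2] at hV
    have hz : 1 - y ≠ 0 := sub_ne_zero.2 hy1.symm
    field_simp at hV ⊢
    linear_combination -hV / 16
  obtain ⟨k, hk⟩ := exists_eq_C_mul_of_wronskian_eq_zero hq hwronskian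
  have hk0 : k ≠ 0 := by
    rintro rfl
    exact hp (by rw [hk, C_0, zero_mul])
  apply hmn
  rw [← natDegree_shiftedSeed h m, hk, natDegree_C_mul hk0, natDegree_shiftedSeed h n]

theorem exists_neg_cos_two_mul_eq (h₀ : 0 < y) (h₁ : y < 1) :
    ∃ θ, 0 < θ ∧ θ < Real.pi / 2 ∧ -Real.cos (2 * θ) = 1 - 2 * y := by
  have hcos : Real.cos (Real.arccos (2 * y - 1)) = 2 * y - 1 :=
    Real.cos_arccos (by linarith) (by linarith)
  have hpos : 0 < Real.arccos (2 * y - 1) := Real.arccos_pos.2 (by linarith)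
  have hlt : Real.arccos (2 * y - 1) < Real.pi := by
    refine (Real.arccos_le_pi _).lt_of_ne fun hpi => ?_
    rw [hpi, Real.cos_pi] at hcos
    linarith
  refine ⟨Real.arccos (2 * y - 1) / 2, by linarith, by linarith, ?_⟩
  rw [mul_div_cancel₀ _ two_ne_zero, hcos, neg_sub]

theorem exists_potential_ne (h : ∀ k : ℤ, α - β ≠ k) (hmn : m ≠ n) :
    ∃ θ ∈ regularAngles m α β ∩ regularAngles n α β,
      ∀ ω r : ℝ, 0 < r → potential ω m α β r θ ≠ potential ω n α β r θ := by
  obtain ⟨y, ⟨⟨hy0, hy1, hm⟩, _, _, hn⟩, hne⟩ := exists_angularPotential_ne h hmn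
  obtain ⟨θ, hθ0, hθ1, hθ⟩ := exists_neg_cos_two_mul_eq hy0 hy1
  rw [← hθ] at hm hn hne
  have hθm : θ ∈ regularAngles m α β := ⟨hθ0, hθ1, hm⟩
  have hθn : θ ∈ regularAngles n α β := ⟨hθ0, hθ1, hn⟩
  refine ⟨θ, ⟨hθm, hθn⟩, fun ω r hr heq => hne ?_⟩
  rw [potential_eq hθm, potential_eq hθn] at heq
  exact mul_left_cancel₀ (by positivity) (add_left_cancel heq)

end GenericParameters

end RationalExtension

end

theorem mainTheorem2 (α β : ℝ) :
    (∀ m : ℕ, RationalExtension.seedPoly m α β ≠ 0 →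
      -- the Hamiltonian is `-Δ/2 + V`
      (∀ (ω : ℝ) (Ψ : ℝ → ℝ → ℝ) (r θ : ℝ), 0 < r → θ ∈ RationalExtension.regularAngles m α β →
        ContDiffAt ℝ 2 (fun p : ℝ × ℝ => Ψ p.1 p.2) (r, -Real.cos (2 * θ)) →
        RationalExtension.hamiltonian ω m α β Ψ r (-Real.cos (2 * θ)) =
          -(1 / 2) * RationalExtension.polarLaplacian (fun s t => Ψ s (-Real.cos (2 * t))) r θ
            + RationalExtension.potential ω m α β r θ * Ψ r (-Real.cos (2 * θ))) ∧
      -- the angular part of the potential is a rational function of `x = -cos 2θ`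
      (∃ N : Polynomial ℝ, ∀ ω r θ : ℝ, 0 < r → θ ∈ RationalExtension.regularAngles m α β →
        RationalExtension.potential ω m α β r θ =
          ω ^ 2 * r ^ 2 / 2 + 1 / r ^ 2 * (N.eval (-Real.cos (2 * θ)) /
            ((1 - Real.cos (2 * θ) ^ 2) *
              (RationalExtension.seedPoly m α β).eval (-Real.cos (2 * θ)) ^ 2))) ∧
      ∃ (W : ℝ → ℝ) (q₇ q₈ q₉ q₁₀ : ℝ),
        -- `W` is a rational function whose poles are zeros of the seed polynomial
        (∃ N : Polynomial ℝ, ∀ y : ℝ,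
          W y = N.eval y / (RationalExtension.seedPoly m α β).eval (1 - 2 * y)) ∧
        -- the potential is given by `W`
        (∀ ω r θ : ℝ, 0 < r → θ ∈ RationalExtension.regularAngles m α β →
          DifferentiableAt ℝ
              (RationalExtension.angularPrimitive (RationalExtension.cotCoeff m α β) W) θ ∧
            RationalExtension.potential ω m α β r θ =
              ω ^ 2 * r ^ 2 / 2 + 1 / r ^ 2 *
                deriv (RationalExtension.angularPrimitive
                  (RationalExtension.cotCoeff m α β) W) θ) ∧
        -- `W` satisfies SD-I.a
        RationalExtension.IsSDIaSolutionOn q₇ q₈ q₉ q₁₀ W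
          (RationalExtension.regularPoints m α β) ∧
        -- `W` is expressed through a solution of the sixth Painlevé equation
        ∃ (γ₁ γ₂ γ₃ γ₄ t : ℝ) (u : ℝ → ℝ) (S : Set ℝ), t ^ 2 = 2 * γ₁ ∧ S.Finite ∧
          RationalExtension.IsPVISolutionOn γ₁ γ₂ γ₃ γ₄ u
            (RationalExtension.regularPoints m α β \ S) ∧
          ∀ y ∈ RationalExtension.regularPoints m α β \ S,
            W y = RationalExtension.cosgroveExpr γ₂ γ₃ γ₄ t u y) ∧
    -- the family is infinite: in the generic case the potentials are pairwise distinct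
    ((∀ k : ℤ, α - β ≠ k) →
      (∀ m : ℕ, RationalExtension.seedPoly m α β ≠ 0) ∧
      ∀ m n : ℕ, m ≠ n →
        ∃ θ ∈ RationalExtension.regularAngles m α β ∩ RationalExtension.regularAngles n α β,
          ∀ ω r : ℝ, 0 < r →
            RationalExtension.potential ω m α β r θ ≠
              RationalExtension.potential ω n α β r θ) := by
  open RationalExtension in
  refine ⟨fun m _ => ⟨fun ω Ψ r θ hr hθ hΨ => hamiltonian_eq hr.ne' hθ hΨ, ?_, ?_⟩,
    fun h => ⟨seedPoly_ne_zero h, fun m n => exists_potential_ne h⟩⟩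
  · obtain ⟨N, hN⟩ := exists_angularPotential_eq_eval_div m α β
    refine ⟨N, fun ω r θ _ hθ => ?_⟩
    rw [potential_eq hθ, hN _ (neg_cos_two_mul_mem_Ioo hθ.1 hθ.2.1) hθ.2.2, neg_sq]
  · obtain ⟨q₇, q₈, q₉, q₁₀, hSDIa⟩ := exists_isSDIaSolutionOn_cosgroveSolution m α β
    refine ⟨cosgroveSolution m α β, q₇, q₈, q₉, q₁₀, ⟨_, fun _ => rfl⟩, fun ω r θ _ hθ => ?_,
      hSDIa, hasPVIRepresentation_cosgroveSolution m α β⟩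
    have hT := hasDerivAt_angularPrimitive_cosgroveSolution hθ
    exact ⟨hT.differentiableAt, by rw [hT.deriv, potential_eq hθ]⟩
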